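/- Let $m\ge 2$ be an integer, and for $s\in\{m,2m\}$ let $\mathrm{Tr}_s:\mathbb F_{3^s}\to\mathbb F_3$ be the trace map. Words of length $3^{2m}$ over $\mathbb F_3$ are indexed by $t\in\mathbb F_{3^{2m}}$, and a function $f:\mathbb F_{3^{2m}}\to\mathbb F_3$ is identified with the word $(f(t))_{t}$. A linear code of this length is called affine-invariant if it is invariant under all coordinate permutations $t\mapsto s_1t+s_2$ with $s_1\in\mathbb F_{3^{2m}}^*$, $s_2\in\mathbb F_{3^{2m}}$. Consider the ternary linear code $$\mathcal C(2m,3)=\left\{\left(\mathrm{Tr}_{2m}(at^{3^m+1}+bt)+h\right)_{t\in\mathbb F_{3^{2m}}}: a\in\mathbb F_{3^m},\ b\in\mathbb F_{3^{2m}},\ h\in\mathbb F_3\right\}.$$ It is affine-invariant, and the supports of its codewords of minimum (nonzero) weight $d$ are the blocks of a $2$-design $\mathbb D_d(\mathcal C(2m,3))$ with point set $\mathbb F_{3^{2m}}$. Let $\mathcal C_3(\mathbb D_d(\mathcal C(2m,3)))$ be the code over $\mathbb F_3$ spanned by the rows of the incidence matrix of this design (rows indexed by blocks, columns by points). Then $\mathcal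 C_3(\mathbb D_d(\mathcal C(2m,3)))$ is spanned over $\mathbb F_3$ by $$\left\{\begin{matrix}\displaystyle\sum_{i=0}^{m-1}\mathrm{Tr}_{2m}\big(b_it^{(3^m+1)3^i+1}\big)+\sum_{i=0}^{2m-1}\mathrm{Tr}_{2m}\big(b_i't^{3^i+1}\big)+\sum_{i=0}^{m-1}\mathrm{Tr}_{m}\big(c_it^{(3^m+1)(3^i+1)}\big)+\mathrm{Tr}_{2m}(bt)+h:\\ b,b_i,b_i'\in\mathbb F_{3^{2m}},\ c_i\in\mathbb F_{3^m},\ h\in\mathbb F_3\end{matrix}\right\}.$$ Moreover, $\mathcal C_3(\mathbb D_d(\mathcal C(2m,3)))$ is affine-invariant, and it holds $2$-designs: for every $k\geq 1$ for which it has a codeword of Hamming weight $k$, the set of supports of its codewords of weight $k$ is the block set of a $2$-$(3^{2m},k,\lambda)$ design for some $\lambda\ge 1$ (in particular $k\ge 2$). -/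

import Mathlib

noncomputable section

namespace HermitianDesign

/-! ### Codes and designs on a finite point set -/

section General

variable {P : Type*} [Fintype P]

/-- The support of a ternary word whose coordinates are indexed by `P`. -/
def wordSupport (c : P → ZMod 3) : Finset P :=
  Finset.univ.filter fun x => c x ≠ 0

/-- The set of (distinct) supports of the codewords of Hamming weight `k` of a ternary code. -/
def supportBlocks (C : Submodule (ZMod 3) (P → ZMod 3)) (k : ℕ) : Set (Finset P) :=
  {B | ∃ c ∈ C, hammingNorm c = k ∧ B = wordSupport c}

/-- The minimum weight of a (nonzero) ternary linear code. -/
def minWeight (C : Submodule (ZMod 3) (P → ZMod 3)) : ℕ :=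
  sInf {w | ∃ c ∈ C, c ≠ 0 ∧ hammingNorm c = w}

/-- `(P, 𝓑)` is a `t`-`(|P|, k, l)` design: `1 ≤ t ≤ k ≤ |P|`, `l ≥ 1`, all blocks have size `k`,
and every `t`-subset of `P` is contained in exactly `l` blocks. -/
structure IsDesign (t k l : ℕ) (𝓑 : Set (Finset P)) : Prop where
  one_le_t : 1 ≤ t
  t_le_k : t ≤ k
  k_le_card : k ≤ Fintype.card P
  l_pos : 0 < l
  card_block : ∀ B ∈ 𝓑, B.card = k
  card_through : ∀ T : Finset P, T.card = t → {B | B ∈ 𝓑 ∧ T ⊆ B}.ncard = l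

/-- A ternary code holds `t`-designs: for every nonzero weight `k` that occurs in the code, the
supports of the codewords of weight `k` are the blocks of a `t`-design. -/
def HoldsDesigns (t : ℕ) (C : Submodule (ZMod 3) (P → ZMod 3)) : Prop :=
  ∀ k : ℕ, 0 < k → (∃ c ∈ C, hammingNorm c = k) → ∃ l, IsDesign t k l (supportBlocks C k)

open Classical in
/-- The incidence matrix over `𝔽₃`, with rows indexed by blocks and columns by points. -/
def incidenceMatrix (𝓑 : Set (Finset P)) : Matrix 𝓑 P (ZMod 3) :=
  Matrix.of fun B x => if x ∈ B.1 then 1 else 0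

/-- The ternary code spanned by the rows of the incidence matrix. -/
def designCode (𝓑 : Set (Finset P)) : Submodule (ZMod 3) (P → ZMod 3) :=
  Submodule.span (ZMod 3) (Set.range (incidenceMatrix 𝓑).row)

end General

section Field

variable {K : Type*} [Field K]

/-- A code with coordinates indexed by a finite field is affine-invariant if it is invariant under
all coordinate permutations `x ↦ s₁ x + s₂` with `s₁ ≠ 0`. -/
def AffineInvariant (C : Submodule (ZMod 3) (K → ZMod 3)) : Prop :=
  ∀ s₁ s₂ : K, s₁ ≠ 0 → ∀ c ∈ C, (fun x => c (s₁ * x + s₂)) ∈ C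

variable [Algebra (ZMod 3) K]

theorem charP_three (K : Type*) [Field K] [Algebra (ZMod 3) K] : CharP K 3 :=
  charP_of_injective_algebraMap (algebraMap (ZMod 3) K).injective 3

/-- The subfield `{x | x ^ 3 ^ m = x}` of `K`, which is `𝔽_{3^m}` when `K = 𝔽_{3^{2m}}`. -/
def halfField (K : Type*) [Field K] [Algebra (ZMod 3) K] (m : ℕ) :
    IntermediateField (ZMod 3) K where
  carrier := {x | x ^ 3 ^ m = x}
  mul_mem' := by
    intro a b ha hb
    simp only [Set.mem_ofPred_eq] at *
    rw [mul_pow, ha, hb]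
  add_mem' := by
    intro a b ha hb
    have := charP_three K
    simp only [Set.mem_ofPred_eq] at *
    rw [add_pow_char_pow, ha, hb]
  algebraMap_mem' := by
    intro r
    simp only [Set.mem_ofPred_eq]
    rw [← map_pow, ZMod.pow_card_pow]
  inv_mem' := by
    intro a ha
    simp only [Set.mem_ofPred_eq] at *
    rw [inv_pow, ha]

/-- The powers `t ^ ((3 ^ m + 1) k)` lie in `𝔽_{3^m}`. -/
theorem pow_mem_halfField [Fintype K] {m : ℕ} (hK : Fintype.card K = 3 ^ (2 * m)) (t : K)
    (k : ℕ) : t ^ ((3 ^ m + 1) * k) ∈ halfField K m := by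
  change (t ^ ((3 ^ m + 1) * k)) ^ 3 ^ m = t ^ ((3 ^ m + 1) * k)
  have h : t ^ (3 ^ m * 3 ^ m) = t := by
    rw [← pow_add, ← two_mul, ← hK, FiniteField.pow_card]
  have h' : (t ^ (3 ^ m + 1)) ^ 3 ^ m = t ^ (3 ^ m + 1) := by
    rw [← pow_mul, add_mul, one_mul, pow_add, h, pow_succ, mul_comm]
  rw [pow_mul, ← pow_mul, mul_comm k, pow_mul, h']

/-- The word `c(a,b,h) = (Tr_{2m}(a t^{3^m+1} + b t) + h)_t`. -/
def hermitianWord (m : ℕ) (a : halfField K m) (b : K) (h : ZMod 3) : K → ZMod 3 :=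
  fun t => Algebra.trace (ZMod 3) K ((a : K) * t ^ (3 ^ m + 1) + b * t) + h

/-- The ternary linear code `𝒞(2m,3) = {c(a,b,h)}`. -/
def hermitianCode (K : Type*) [Field K] [Algebra (ZMod 3) K] (m : ℕ) :
    Submodule (ZMod 3) (K → ZMod 3) where
  carrier := {c | ∃ (a : halfField K m) (b : K) (h : ZMod 3), c = hermitianWord m a b h}
  add_mem' := by
    rintro _ _ ⟨a, b, h, rfl⟩ ⟨a', b', h', rfl⟩
    refine ⟨a + a', b + b', h + h', ?_⟩
    funext t
    simp only [hermitianWord, Pi.add_apply, IntermediateField.coe_add, add_mul, map_add]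
    ring
  zero_mem' := ⟨0, 0, 0, by funext t; simp [hermitianWord]⟩
  smul_mem' := by
    rintro r _ ⟨a, b, h, rfl⟩
    refine ⟨r • a, r • b, r * h, ?_⟩
    funext t
    simp only [hermitianWord, Pi.smul_apply, IntermediateField.coe_smul, smul_mul_assoc,
      ← smul_add, map_smul, smul_eq_mul]
    ring

variable [Fintype K]

/-- The blocks of `𝔻_d(𝒞(2m,3))`: the supports of the codewords of minimum weight `d`. -/
def hermitianBlocks (K : Type*) [Field K] [Algebra (ZMod 3) K] [Fintype K] (m : ℕ) :
    Set (Finset K) :=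
  supportBlocks (hermitianCode K m) (minWeight (hermitianCode K m))

/-- The evaluation word
`∑_{i<m} Tr_{2m}(bᵢ t^{(3^m+1)3^i+1}) + ∑_{i<2m} Tr_{2m}(b'ᵢ t^{3^i+1})
  + ∑_{i<m} Tr_m(cᵢ t^{(3^m+1)(3^i+1)}) + Tr_{2m}(b t) + h`. -/
def spanningWord {m : ℕ} (hK : Fintype.card K = 3 ^ (2 * m)) (b₁ : Fin m → K)
    (b₂ : Fin (2 * m) → K) (c : Fin m → halfField K m) (b : K) (h : ZMod 3) : K → ZMod 3 :=
  fun t =>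
    (∑ i : Fin m, Algebra.trace (ZMod 3) K (b₁ i * t ^ ((3 ^ m + 1) * 3 ^ (i : ℕ) + 1)))
    + (∑ i : Fin (2 * m), Algebra.trace (ZMod 3) K (b₂ i * t ^ (3 ^ (i : ℕ) + 1)))
    + (∑ i : Fin m, Algebra.trace (ZMod 3) (halfField K m)
        (c i * ⟨t ^ ((3 ^ m + 1) * (3 ^ (i : ℕ) + 1)), pow_mem_halfField hK t _⟩))
    + Algebra.trace (ZMod 3) K (b * t) + h

end Field

end HermitianDesign

end

noncomputable section

namespace HermitianDesign

/-! Write `C` for the Hermitian code, `D` for the code of its minimum-weight design, `q = 3 ^ m`.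
The core is the identity `D = C * C` (componentwise products). In `𝔽₃` the square `x * x` indicates
`x ≠ 0`, so the row of a block is the square of its codeword and `D ≤ C * C`. Conversely, since `u *
v = u² + v² - (u + v)²` in characteristic 3, it suffices that `D` contains the square of every
codeword. Completing the square and counting norm fibres shows that translates of `Tr(a t^(q+1)) +
h` with `a, h ≠ 0` have minimum weight. Summing squares over all `a` gives `1 ∈ D`; this is where `m
≥ 2` enters. Combinations of such squares then produce all the others
(`mul_self_mem_hermitianDesignCode_of_mem`). The identity `Tr x * Tr y = ∑ Tr(x^(3^i) * y)` expands
products of codewords into the listed words. Averaging over units isolates each summand, which gives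
the reverse inclusion (`hermitianCode_mul_self`). Affine invariance passes from `C` to `C * C`, and
the affine group is 2-transitive, so every weight at least 2 yields a 2-design. Weight 1 cannot
occur in `D`: block sizes are divisible by 3, so the entries of each word of `D` sum to zero. -/

theorem hammingNorm_eq_card_wordSupport {P : Type*} [Fintype P] (c : P → ZMod 3) :
    hammingNorm c = (wordSupport c).card := by
  simp [hammingNorm, wordSupport]

theorem hammingNorm_add_card_zeros {P : Type*} [Fintype P] (c : P → ZMod 3) :
    hammingNorm c + (Finset.univ.filter fun t => c t = 0).card = Fintype.card P := by
  have := Finset.card_filter_add_card_filter_not (s := (Finset.univ : Finset P)) (fun t => c t = 0)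
  rw [hammingNorm_eq_card_wordSupport, wordSupport, add_comm, this, Finset.card_univ]

theorem hammingNorm_comp_bijective {P : Type*} [Fintype P] (c : P → ZMod 3) {σ : P → P}
    (hσ : Function.Bijective σ) : hammingNorm (fun x => c (σ x)) = hammingNorm c := by
  simp only [hammingNorm]
  exact Finset.card_bij (fun x _ => σ x) (by simp) (fun _ _ _ _ h => hσ.1 h) fun y hy => by
    obtain ⟨x, rfl⟩ := hσ.2 y
    exact ⟨x, by simpa using hy, rfl⟩

/-! ### Designs from 2-transitivity of the affine group -/

section Designs

variable {K : Type*} [Field K] [Fintype K]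

theorem affine_bijective {s₁ : K} (h : s₁ ≠ 0) (s₂ : K) :
    Function.Bijective fun x : K => s₁ * x + s₂ :=
  Finite.injective_iff_bijective.1 fun _ _ hxy => mul_left_cancel₀ h (add_right_cancel hxy)

/-- An affine-invariant code has equally many weight-`k` supports through any two pairs. -/
theorem AffineInvariant.ncard_through_le {C : Submodule (ZMod 3) (K → ZMod 3)}
    (hC : AffineInvariant C) (k : ℕ) {T T' : Finset K} (hT : T.card = 2) (hT' : T'.card = 2) :
    {B | B ∈ supportBlocks C k ∧ T ⊆ B}.ncard ≤ {B | B ∈ supportBlocks C k ∧ T' ⊆ B}.ncard := by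
  classical
  obtain ⟨x, y, hxy, rfl⟩ := Finset.card_eq_two.1 hT
  obtain ⟨x', y', hxy', rfl⟩ := Finset.card_eq_two.1 hT'
  have hd : x' - y' ≠ 0 := sub_ne_zero.2 hxy'
  -- The affine map sending the pair `T'` to `T`; taking preimages under it injects the blocks
  -- through `T` into those through `T'`.
  obtain ⟨s₁, s₂, hs, hx, hy⟩ : ∃ s₁ s₂ : K, s₁ ≠ 0 ∧ s₁ * x' + s₂ = x ∧ s₁ * y' + s₂ = y :=
    ⟨(x - y) / (x' - y'), x - (x - y) / (x' - y') * x', div_ne_zero (sub_ne_zero.2 hxy) hd,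
      by ring, by field_simp; ring⟩
  have hσ := affine_bijective hs s₂
  refine Set.ncard_le_ncard_of_injOn
    (fun B => Finset.univ.filter fun z => s₁ * z + s₂ ∈ B) ?_ ?_ (Set.toFinite _)
  · rintro _ ⟨⟨c, hc, hk, rfl⟩, hsub⟩
    refine ⟨⟨_, hC s₁ s₂ hs c hc, (hammingNorm_comp_bijective c hσ).trans hk, ?_⟩, ?_⟩
    · ext z; simp [wordSupport]
    · intro z hz
      rw [Finset.mem_insert, Finset.mem_singleton] at hz
      rw [Finset.mem_filter]
      refine ⟨Finset.mem_univ _, hsub ?_⟩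
      rcases hz with rfl | rfl <;> simp [hx, hy]
  · intro B _ B' _ h
    ext z
    obtain ⟨w, rfl⟩ := hσ.2 z
    simpa using Finset.ext_iff.1 h w

/-- In an affine-invariant code the supports of any occurring weight `k ≥ 2` form a 2-design. -/
theorem AffineInvariant.exists_isDesign {C : Submodule (ZMod 3) (K → ZMod 3)}
    (hC : AffineInvariant C) {k : ℕ} (hk : 2 ≤ k) (hex : ∃ c ∈ C, hammingNorm c = k) :
    ∃ l, IsDesign 2 k l (supportBlocks C k) := by
  obtain ⟨c, hc, hck⟩ := hex
  obtain ⟨T, hTs, hT⟩ := Finset.exists_subset_card_eq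
    (hk.trans_eq (hck.symm.trans (hammingNorm_eq_card_wordSupport c)))
  refine ⟨{B | B ∈ supportBlocks C k ∧ T ⊆ B}.ncard, by norm_num, hk, ?_, ?_, ?_, fun T' hT' =>
    le_antisymm (hC.ncard_through_le k hT' hT) (hC.ncard_through_le k hT hT')⟩
  · rw [← hck]; exact hammingNorm_le_card_fintype
  · rw [Set.ncard_pos (Set.toFinite _)]
    exact ⟨_, ⟨c, hc, hck, rfl⟩, hTs⟩
  · rintro _ ⟨c', _, hk', rfl⟩
    rw [← hk', hammingNorm_eq_card_wordSupport]

end Designs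

/-! ### Fibres of additive maps to `𝔽₃` -/

section Fibers

theorem surjective_of_ne_zero {G : Type*} [AddGroup G] {f : G →+ ZMod 3} (hf : f ≠ 0) : Function.Surjective f := by
  obtain ⟨g, hg⟩ := DFunLike.ne_iff.1 hf
  replace hg : f g ≠ 0 := hg
  intro c
  refine ⟨(c * (f g)⁻¹).val • g, ?_⟩
  rw [map_nsmul, nsmul_eq_mul, ZMod.natCast_zmod_val, mul_assoc, inv_mul_cancel₀ hg, mul_one]

variable {G : Type*} [AddGroup G] [Fintype G]

theorem three_mul_card_fiber {f : G →+ ZMod 3} (hf : f ≠ 0) (c : ZMod 3) :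
    3 * (Finset.univ.filter fun g => f g = c).card = Fintype.card G := by
  have hs := surjective_of_ne_zero hf
  have h := Finset.card_eq_sum_card_fiberwise (s := (Finset.univ : Finset G))
    (t := Finset.univ) (f := f) (fun _ _ => by simp)
  rw [← Finset.card_univ, h, Finset.sum_congr rfl fun b _ =>
    AddMonoidHom.card_fiber_eq_of_mem_range f (hs b) (hs c)]
  simp

/-- Fibres of a nonzero `f` have size `|G| / 3`, still divisible by 3, so each contributes zero.
This is why 9, not just 3, must divide `|G|`. -/
theorem sum_comp_eq_zero (hG : 9 ∣ Fintype.card G) (f : G →+ ZMod 3) (φ : ZMod 3 → ZMod 3) :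
    ∑ g, φ (f g) = 0 := by
  have h3 : (3 : ZMod 3) = 0 := rfl
  obtain ⟨n, hn⟩ := hG
  by_cases hf : f = 0
  · subst hf
    rw [show ((9 : ℕ) * n) = 3 * (3 * n) by ring] at hn
    simp [hn, h3]
  · rw [← Finset.sum_fiberwise_of_maps_to (t := Finset.univ) (g := f) (by simp)]
    refine Finset.sum_eq_zero fun c _ => ?_
    rw [Finset.sum_congr rfl (g := fun _ => φ c) fun g hg => by rw [(Finset.mem_filter.1 hg).2]]
    have hc : (Finset.univ.filter fun g => f g = c).card = 3 * n := by
      have := three_mul_card_fiber hf c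
      omega
    simp [hc, h3]

end Fibers

/-! ### Traces, their products, and sums over units -/

section Trace

variable {L : Type*} [Field L] [Fintype L] [Algebra (ZMod 3) L]

theorem finrank_eq_of_card {n : ℕ} (hL : Fintype.card L = 3 ^ n) :
    Module.finrank (ZMod 3) L = n := by
  have h := Module.card_eq_pow_finrank (K := ZMod 3) (V := L)
  rw [hL, ZMod.card] at h
  exact (Nat.pow_right_injective (by norm_num) h).symm

theorem algebraMap_trace_eq_sum {n : ℕ} (hL : Fintype.card L = 3 ^ n) (x : L) :
    algebraMap (ZMod 3) L (Algebra.trace (ZMod 3) L x) = ∑ i : Fin n, x ^ 3 ^ (i : ℕ) := by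
  rw [FiniteField.algebraMap_trace_eq_sum_pow, finrank_eq_of_card hL, Finset.sum_range]
  simp

theorem trace_pow_three_pow (x : L) (n : ℕ) :
    Algebra.trace (ZMod 3) L (x ^ 3 ^ n) = Algebra.trace (ZMod 3) L x := by
  induction n with
  | zero => simp
  | succ n ih =>
    have h := Algebra.trace_eq_of_algEquiv
      (FiniteField.frobeniusAlgEquivOfAlgebraic (ZMod 3) L) (x ^ 3 ^ n)
    rw [← ih, ← h]
    simp [pow_succ, pow_mul]

/-- The additive map `x ↦ Tr(a x)`. -/
def traceMul {L : Type*} [Field L] [Algebra (ZMod 3) L] (a : L) : L →+ ZMod 3 :=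
  (Algebra.trace (ZMod 3) L).toAddMonoidHom.comp (AddMonoidHom.mulLeft a)

theorem traceMul_apply {L : Type*} [Field L] [Algebra (ZMod 3) L] (a x : L) : traceMul a x = Algebra.trace (ZMod 3) L (a * x) := rfl

theorem traceMul_ne_zero {a : L} (ha : a ≠ 0) : traceMul a ≠ 0 := by
  obtain ⟨y, hy⟩ := Algebra.trace_surjective (ZMod 3) L 1
  intro h
  have := DFunLike.congr_fun h (a⁻¹ * y)
  rw [traceMul_apply, mul_inv_cancel_left₀ ha, hy] at this
  exact one_ne_zero this

/-- Orthogonality of the characters `a ↦ a ^ 3 ^ k` of the cyclic group `Lˣ`: the exponents `3 ^ k`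
with `k < n` are distinct modulo `3 ^ n - 1`. -/
theorem sum_units_pow_mul_inv_pow [DecidableEq L] {n : ℕ} (hL : Fintype.card L = 3 ^ n) {i k : ℕ} (hi : i < n)
    (hk : k < n) :
    ∑ a : Lˣ, (a : L) ^ 3 ^ k * ((a : L) ^ 3 ^ i)⁻¹ = if k = i then -1 else 0 := by
  have h3 : ∀ j, j < n → 3 * 3 ^ j ≤ 3 ^ n := fun j hj => by
    rw [← pow_succ']; exact Nat.pow_le_pow_right (by norm_num) hj
  have hi' := h3 i hi
  have hk' := h3 k hk
  have hi0 : 0 < 3 ^ i := by positivity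
  have hk0 : 0 < 3 ^ k := by positivity
  -- The inverse of `a ^ 3 ^ i` is rewritten as the power with exponent `3 ^ n - 1 - 3 ^ i`.
  have key := FiniteField.sum_pow_units L (3 ^ k + (3 ^ n - 1 - 3 ^ i))
  rw [hL] at key
  have hdvd : 3 ^ n - 1 ∣ 3 ^ k + (3 ^ n - 1 - 3 ^ i) ↔ k = i := by
    constructor
    · rintro ⟨c, hc⟩
      have hc1 : c = 1 := by
        rcases c with _ | _ | c
        · omega
        · rfl
        · exfalso
          have : (3 ^ n - 1) * 2 ≤ (3 ^ n - 1) * (c + 1 + 1) := Nat.mul_le_mul_left _ (by omega)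
          omega
      rw [hc1, mul_one] at hc
      exact Nat.pow_right_injective (by norm_num) (by omega : 3 ^ k = 3 ^ i)
    · rintro rfl
      exact ⟨1, by omega⟩
  simp only [hdvd] at key
  rw [← key]
  refine Finset.sum_congr rfl fun a _ => ?_
  rw [pow_add]
  congr 1
  refine inv_eq_of_mul_eq_one_right ?_
  rw [← pow_add, show 3 ^ i + (3 ^ n - 1 - 3 ^ i) = 3 ^ n - 1 by omega, ← hL]
  exact FiniteField.pow_card_sub_one_eq_one _ a.ne_zero

variable {E : Type*} [Field E] [Algebra (ZMod 3) E] [Algebra L E] [IsScalarTower (ZMod 3) L E]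

/-- The scalar `Tr x` moves inside the `𝔽₃`-linear trace of `E`, where it expands as the sum of the
conjugates of `x`. -/
theorem trace_mul_trace {n : ℕ} (hL : Fintype.card L = 3 ^ n) (x : L) (y : E) :
    Algebra.trace (ZMod 3) L x * Algebra.trace (ZMod 3) E y =
      ∑ i : Fin n, Algebra.trace (ZMod 3) E (algebraMap L E x ^ 3 ^ (i : ℕ) * y) := by
  rw [← smul_eq_mul, ← map_smul, Algebra.smul_def, IsScalarTower.algebraMap_apply (ZMod 3) L E,
    algebraMap_trace_eq_sum hL, map_sum, Finset.sum_mul, map_sum]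
  simp

/-- Summing over the units of `L` isolates a single term of the product of two traces. -/
theorem sum_units_trace_mul_trace [DecidableEq L] {n : ℕ} (hL : Fintype.card L = 3 ^ n) (i : Fin n) (x : L)
    (β y : E) :
    ∑ a : Lˣ, Algebra.trace (ZMod 3) L (a * x) *
        Algebra.trace (ZMod 3) E (β * algebraMap L E ((a : L) ^ 3 ^ (i : ℕ))⁻¹ * y) =
      -Algebra.trace (ZMod 3) E (β * (algebraMap L E x ^ 3 ^ (i : ℕ) * y)) := by
  simp_rw [trace_mul_trace hL]
  rw [Finset.sum_comm]
  have h : ∀ k : Fin n, ∑ a : Lˣ, Algebra.trace (ZMod 3) E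
      (algebraMap L E (a * x) ^ 3 ^ (k : ℕ) *
        (β * algebraMap L E ((a : L) ^ 3 ^ (i : ℕ))⁻¹ * y)) =
      if k = i then -Algebra.trace (ZMod 3) E (β * (algebraMap L E x ^ 3 ^ (i : ℕ) * y))
        else 0 := by
    intro k
    have h1 : ∀ a : Lˣ, algebraMap L E (a * x) ^ 3 ^ (k : ℕ) *
        (β * algebraMap L E ((a : L) ^ 3 ^ (i : ℕ))⁻¹ * y) =
        algebraMap L E ((a : L) ^ 3 ^ (k : ℕ) * ((a : L) ^ 3 ^ (i : ℕ))⁻¹) *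
          (β * (algebraMap L E x ^ 3 ^ (k : ℕ) * y)) := fun a => by
      simp only [map_mul, map_pow, mul_pow]; ring
    simp_rw [h1]
    rw [← map_sum, ← Finset.sum_mul, ← map_sum, sum_units_pow_mul_inv_pow hL i.2 k.2]
    by_cases hki : k = i
    · subst hki; simp
    · simp [hki, Fin.val_inj]
  simp_rw [h]
  simp

end Trace

/-! ### The subfield of order `3 ^ m` and its norm map -/

section HalfField

variable {K : Type*} [Field K] [Algebra (ZMod 3) K] [Fintype K] {m : ℕ}

/-- The norm `t ↦ t ^ (3 ^ m + 1)` from `𝔽_{3^{2m}}` to `𝔽_{3^m}`. -/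
def halfNorm (hK : Fintype.card K = 3 ^ (2 * m)) (t : K) : halfField K m :=
  ⟨t ^ (3 ^ m + 1), by simpa using pow_mem_halfField hK t 1⟩

instance : Fintype (halfField K m) := Fintype.ofFinite _

theorem pow_pow_eq_self (hK : Fintype.card K = 3 ^ (2 * m)) (t : K) :
    (t ^ 3 ^ m) ^ 3 ^ m = t := by
  rw [← pow_mul, ← pow_add, ← two_mul, ← hK, FiniteField.pow_card]

-- A fibre consists of roots of `X ^ (3 ^ m + 1) - y`.
open Classical in
theorem card_halfNorm_fiber_le (hK : Fintype.card K = 3 ^ (2 * m)) (y : halfField K m) :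
    (Finset.univ.filter fun t : K => halfNorm hK t = y).card ≤ 3 ^ m + 1 := by
  refine le_trans ?_ (Polynomial.card_nthRoots (3 ^ m + 1) (y : K))
  refine le_trans (Finset.card_le_card (t := (Polynomial.nthRoots (3 ^ m + 1) (y : K)).toFinset)
    fun t ht => ?_) (Multiset.toFinset_card_le _)
  rw [Multiset.mem_toFinset, Polynomial.mem_nthRoots (by positivity)]
  exact congrArg Subtype.val (Finset.mem_filter.1 ht).2

theorem card_halfField_le (hm : m ≠ 0) : Fintype.card (halfField K m) ≤ 3 ^ m := by
  classical
  have h1 : 3 ≤ 3 ^ m := Nat.le_self_pow hm 3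
  rw [Fintype.card_eq_card_units_add_one]
  suffices h : Fintype.card (halfField K m)ˣ ≤ 3 ^ m - 1 by omega
  refine le_trans ?_ (Polynomial.card_nthRoots (3 ^ m - 1) (1 : K))
  refine le_trans ?_ (Multiset.toFinset_card_le _)
  refine Finset.card_le_card_of_injOn (fun u => ((u : halfField K m) : K)) (fun u _ => ?_)
    fun u _ v _ h => Units.ext (Subtype.ext h)
  have hu : ((u : halfField K m) : K) ≠ 0 := fun h => u.ne_zero (Subtype.ext h)
  have hq : ((u : halfField K m) : K) ^ 3 ^ m = ((u : halfField K m) : K) :=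
    (u : halfField K m).2
  rw [Finset.mem_coe, Multiset.mem_toFinset, Polynomial.mem_nthRoots (by omega)]
  refine mul_right_cancel₀ hu ?_
  rw [← pow_succ, Nat.sub_add_cancel (by omega), hq, one_mul]

theorem halfNorm_eq_zero (hK : Fintype.card K = 3 ^ (2 * m)) {t : K} :
    halfNorm hK t = 0 ↔ t = 0 := by
  rw [← Subtype.coe_inj]
  simp [halfNorm]

open Classical in
theorem sum_card_halfNorm_fiber (hK : Fintype.card K = 3 ^ (2 * m)) :
    ∑ y ∈ (Finset.univ : Finset (halfField K m)).erase 0,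
      (Finset.univ.filter fun t : K => halfNorm hK t = y).card = (3 ^ m - 1) * (3 ^ m + 1) := by
  have h := Finset.card_eq_sum_card_fiberwise (s := (Finset.univ : Finset K))
    (t := Finset.univ) (f := halfNorm hK) (fun _ _ => by simp)
  rw [← Finset.add_sum_erase _ _ (Finset.mem_univ 0), Finset.card_univ, hK] at h
  have h0 : (Finset.univ.filter fun t : K => halfNorm hK t = 0).card = 1 :=
    Finset.card_eq_one.2 ⟨0, by ext t; simp [halfNorm_eq_zero]⟩
  rw [h0, mul_comm 2, pow_mul] at h
  have h1 : 1 ≤ 3 ^ m := Nat.one_le_pow _ _ (by norm_num)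
  obtain ⟨n, hn⟩ := Nat.exists_eq_add_of_le h1
  rw [hn] at h ⊢
  rw [Nat.add_sub_cancel_left]
  nlinarith [h]

/-- The `(3 ^ m - 1)(3 ^ m + 1)` nonzero elements of `K` fall into norm fibres of size at most `3 ^
m + 1`, so at least `3 ^ m - 1` nonzero values are needed. -/
theorem card_halfField (hm : m ≠ 0) (hK : Fintype.card K = 3 ^ (2 * m)) :
    Fintype.card (halfField K m) = 3 ^ m := by
  classical
  refine le_antisymm (card_halfField_le hm) ?_
  have h := (sum_card_halfNorm_fiber hK).symm.trans_le
    (Finset.sum_le_card_nsmul _ _ _ fun y _ => card_halfNorm_fiber_le hK y)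
  rw [Finset.card_erase_of_mem (Finset.mem_univ _), Finset.card_univ, smul_eq_mul] at h
  have := Nat.le_of_mul_le_mul_right h (by positivity)
  have : 0 < Fintype.card (halfField K m) := Fintype.card_pos
  omega

-- The upper bounds on the fibre sizes add up to the exact total, so each of them is attained.
open Classical in
theorem card_halfNorm_fiber (hm : m ≠ 0) (hK : Fintype.card K = 3 ^ (2 * m))
    {y : halfField K m} (hy : y ≠ 0) :
    (Finset.univ.filter fun t : K => halfNorm hK t = y).card = 3 ^ m + 1 := by
  refine (Finset.sum_eq_sum_iff_of_le fun y _ => card_halfNorm_fiber_le hK y).1 ?_ y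
    (Finset.mem_erase.2 ⟨hy, Finset.mem_univ _⟩)
  rw [sum_card_halfNorm_fiber, Finset.sum_const, Finset.card_erase_of_mem (Finset.mem_univ _),
    Finset.card_univ, card_halfField hm hK, smul_eq_mul]

/-- `K` has degree 2 over the subfield, so the relative trace of `y` is `2y = -y`. -/
theorem trace_coe_halfField (hm : m ≠ 0) (hK : Fintype.card K = 3 ^ (2 * m))
    (y : halfField K m) :
    Algebra.trace (ZMod 3) K (y : K) = -Algebra.trace (ZMod 3) (halfField K m) y := by
  have hr : Module.finrank (halfField K m) K = 2 := by
    have h := Module.card_eq_pow_finrank (K := halfField K m) (V := K)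
    rw [hK, card_halfField hm hK, ← pow_mul] at h
    have := Nat.pow_right_injective (by norm_num) h
    exact (Nat.eq_of_mul_eq_mul_left (Nat.pos_of_ne_zero hm) ((mul_comm m 2).trans this)).symm
  rw [← Algebra.trace_trace (S := halfField K m)]
  have h : Algebra.trace (halfField K m) K (y : K) = 2 • y := by
    rw [← hr]; exact Algebra.trace_algebraMap y
  rw [h, map_nsmul, nsmul_eq_mul]
  have : ((2 : ℕ) : ZMod 3) = -1 := rfl
  rw [this, neg_one_mul]

end HalfField

/-! ### Affine substitution and weights in the Hermitian code -/

section Weights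

variable {K : Type*} [Field K] [Algebra (ZMod 3) K] [Fintype K] {m : ℕ}

theorem hermitianWord_mem (a : halfField K m) (b : K) (h : ZMod 3) :
    hermitianWord m a b h ∈ hermitianCode K m := ⟨a, b, h, rfl⟩

theorem hermitianWord_affine (hK : Fintype.card K = 3 ^ (2 * m)) (a : halfField K m) (b : K)
    (h : ZMod 3) (s₁ s₂ t : K) :
    hermitianWord m a b h (s₁ * t + s₂) =
      hermitianWord m (a * halfNorm hK s₁) ((b + 2 * a * s₂ ^ 3 ^ m) * s₁)
        (h + Algebra.trace (ZMod 3) K ((a : K) * s₂ ^ (3 ^ m + 1) + b * s₂)) t := by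
  have := charP_three K
  have ha : (a : K) ^ 3 ^ m = a := a.2
  -- The two cross terms of `(s₁ t + s₂) ^ (3 ^ m + 1)` are conjugate under the `3 ^ m`-power map,
  -- so their traces agree; hence the factor 2 in the new linear coefficient.
  have key : Algebra.trace (ZMod 3) K ((a : K) * (s₁ * t) ^ 3 ^ m * s₂) =
      Algebra.trace (ZMod 3) K (a * s₂ ^ 3 ^ m * s₁ * t) := by
    rw [← trace_pow_three_pow _ m, mul_pow, mul_pow, ha, pow_pow_eq_self hK]
    congr 1; ring
  have e1 : (a : K) * (s₁ * t + s₂) ^ (3 ^ m + 1) + b * (s₁ * t + s₂) =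
      (a * s₁ ^ (3 ^ m + 1) * t ^ (3 ^ m + 1) + b * s₁ * t + a * s₂ ^ 3 ^ m * s₁ * t) +
      (a * (s₁ * t) ^ 3 ^ m * s₂) + (a * s₂ ^ (3 ^ m + 1) + b * s₂) := by
    rw [pow_succ, add_pow_char_pow, mul_pow]; ring
  have e2 : ((a * halfNorm hK s₁ : halfField K m) : K) * t ^ (3 ^ m + 1) +
      (b + 2 * a * s₂ ^ 3 ^ m) * s₁ * t =
      (a * s₁ ^ (3 ^ m + 1) * t ^ (3 ^ m + 1) + b * s₁ * t + a * s₂ ^ 3 ^ m * s₁ * t) +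
      a * s₂ ^ 3 ^ m * s₁ * t := by
    simp only [halfNorm, MulMemClass.coe_mul]; ring
  simp only [hermitianWord]
  rw [e1, e2]
  simp only [map_add, key]
  ring

theorem affineInvariant_hermitianCode (hK : Fintype.card K = 3 ^ (2 * m)) :
    AffineInvariant (hermitianCode K m) := by
  rintro s₁ s₂ - _ ⟨a, b, h, rfl⟩
  exact ⟨_, _, _, funext fun t => hermitianWord_affine hK a b h s₁ s₂ t⟩

/-- Completing the square. -/
theorem exists_hermitianWord_eq_translate (hK : Fintype.card K = 3 ^ (2 * m))
    {a : halfField K m} (ha : a ≠ 0) (b : K) (h : ZMod 3) :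
    ∃ (s : K) (h' : ZMod 3), ∀ k, hermitianWord m a b (h + k) =
      fun t => hermitianWord m a 0 (h' + k) (1 * t + s) := by
  have ha' : (a : K) ≠ 0 := fun h => ha (Subtype.ext h)
  have h2 : (2 : K) ≠ 0 := by
    rw [← map_ofNat (algebraMap (ZMod 3) K) 2]
    exact (map_ne_zero _).2 (by decide)
  -- The shift `s` solves `2 * a * s ^ 3 ^ m = b`, as the `3 ^ m`-power map is an involution.
  refine ⟨(b / (2 * a)) ^ 3 ^ m, h - Algebra.trace (ZMod 3) K
    ((a : K) * ((b / (2 * a)) ^ 3 ^ m) ^ (3 ^ m + 1) + 0 * (b / (2 * a)) ^ 3 ^ m), fun k => ?_⟩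
  funext t
  rw [hermitianWord_affine hK, pow_pow_eq_self hK]
  have h1 : a * halfNorm hK 1 = a := Subtype.ext (by simp [halfNorm])
  have h3 : (0 + 2 * (a : K) * (b / (2 * a))) * 1 = b := by field_simp; ring
  rw [h1, h3]
  congr 1; ring

/-- A third of the subfield elements `y` satisfy `Tr_m(a y) = -c`. As `c ≠ 0` excludes `y = 0`, each
is the norm of exactly `3 ^ m + 1` elements. -/
theorem three_mul_card_trace_halfNorm (hm : m ≠ 0) (hK : Fintype.card K = 3 ^ (2 * m))
    {a : halfField K m} (ha : a ≠ 0) {c : ZMod 3} (hc : c ≠ 0) :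
    3 * (Finset.univ.filter fun t : K =>
      Algebra.trace (ZMod 3) K ((a : K) * t ^ (3 ^ m + 1)) = c).card = 3 ^ m * (3 ^ m + 1) := by
  classical
  have hT : ∀ t : K, Algebra.trace (ZMod 3) K ((a : K) * t ^ (3 ^ m + 1)) = c ↔
      traceMul a (halfNorm hK t) = -c := fun t => by
    rw [traceMul_apply, ← neg_inj (b := -c), ← trace_coe_halfField hm hK, neg_neg]; rfl
  have hf := three_mul_card_fiber (traceMul_ne_zero ha) (-c)
  rw [card_halfField hm hK] at hf
  simp only [hT]
  rw [Finset.card_eq_sum_card_fiberwise (f := halfNorm hK)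
    (t := Finset.univ.filter fun y => traceMul a y = -c) (fun t ht => by simpa using ht),
    Finset.sum_congr rfl (g := fun _ => 3 ^ m + 1), Finset.sum_const, smul_eq_mul, ← mul_assoc, hf]
  intro y hy
  have hy' : traceMul a y = -c := (Finset.mem_filter.1 hy).2
  have hy0 : y ≠ 0 := by
    rintro rfl
    rw [map_zero] at hy'
    exact hc (neg_eq_zero.1 hy'.symm)
  rw [← card_halfNorm_fiber hm hK hy0]
  congr 1
  ext t
  simp only [Finset.mem_filter, Finset.mem_univ, true_and]
  exact ⟨fun h => h.2, fun h => ⟨h ▸ hy', h⟩⟩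

theorem hammingNorm_translate (c : K → ZMod 3) (s : K) :
    hammingNorm (fun t => c (1 * t + s)) = hammingNorm c :=
  hammingNorm_comp_bijective c (affine_bijective one_ne_zero s)

theorem hammingNorm_hermitianWord_of_ne_zero {n : ℕ}
    (hK : Fintype.card K = 3 ^ (2 * (n + 1))) {a : halfField K (n + 1)} (ha : a ≠ 0)
    {h : ZMod 3} (hh : h ≠ 0) :
    hammingNorm (hermitianWord (n + 1) a 0 h) + 3 ^ n = 6 * (3 ^ n * 3 ^ n) := by
  have h1 := hammingNorm_add_card_zeros (hermitianWord (n + 1) a 0 h)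
  have h2 := three_mul_card_trace_halfNorm n.succ_ne_zero hK ha (neg_ne_zero.2 hh)
  have h3 : ∀ t, hermitianWord (n + 1) a 0 h t = 0 ↔
      Algebra.trace (ZMod 3) K ((a : K) * t ^ (3 ^ (n + 1) + 1)) = -h := fun t => by
    simp [hermitianWord, eq_neg_iff_add_eq_zero]
  simp only [h3] at h1
  rw [hK, mul_comm 2, pow_mul, pow_succ 3 n] at h1
  rw [pow_succ 3 n] at h2
  nlinarith

theorem hammingNorm_hermitianWord_zero {n : ℕ}
    (hK : Fintype.card K = 3 ^ (2 * (n + 1))) {a : halfField K (n + 1)} (ha : a ≠ 0) :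
    hammingNorm (hermitianWord (n + 1) a 0 0) = 6 * (3 ^ n * 3 ^ n) + 2 * 3 ^ n := by
  have h1 := three_mul_card_trace_halfNorm n.succ_ne_zero hK ha (c := 1) (by decide)
  have h2 := three_mul_card_trace_halfNorm n.succ_ne_zero hK ha (c := 2) (by decide)
  have h3 : hammingNorm (hermitianWord (n + 1) a 0 0) =
      (Finset.univ.filter fun t : K =>
        Algebra.trace (ZMod 3) K ((a : K) * t ^ (3 ^ (n + 1) + 1)) = 1).card +
      (Finset.univ.filter fun t : K =>
        Algebra.trace (ZMod 3) K ((a : K) * t ^ (3 ^ (n + 1) + 1)) = 2).card := by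
    classical
    rw [← Finset.card_union_of_disjoint, hammingNorm]
    · congr 1
      ext t
      have : ∀ x : ZMod 3, x ≠ 0 ↔ x = 1 ∨ x = 2 := by decide
      simp [hermitianWord, this]
    · rw [Finset.disjoint_filter]
      intro t _ h1 h2
      rw [h1] at h2
      revert h2; decide
  rw [pow_succ 3 n] at h1 h2 h3
  nlinarith

theorem hammingNorm_hermitianWord_linear {n : ℕ}
    (hK : Fintype.card K = 3 ^ (2 * (n + 1))) {b : K} (hb : b ≠ 0) (h : ZMod 3) :
    hammingNorm (hermitianWord (n + 1) 0 b h) = 6 * (3 ^ n * 3 ^ n) := by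
  have h1 := hammingNorm_add_card_zeros (hermitianWord (n + 1) 0 b h)
  have h2 := three_mul_card_fiber (traceMul_ne_zero hb) (-h)
  have h3 : ∀ t, hermitianWord (n + 1) 0 b h t = 0 ↔ traceMul b t = -h := fun t => by
    simp [hermitianWord, traceMul_apply, eq_neg_iff_add_eq_zero]
  simp only [h3] at h1
  rw [hK, mul_comm 2, pow_mul, pow_succ 3 n] at h1 h2
  nlinarith

theorem hammingNorm_hermitianWord_const {n : ℕ}
    (hK : Fintype.card K = 3 ^ (2 * (n + 1))) {h : ZMod 3} (hh : h ≠ 0) :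
    hammingNorm (hermitianWord (K := K) (n + 1) 0 0 h) = 9 * (3 ^ n * 3 ^ n) := by
  have h1 := hammingNorm_add_card_zeros (hermitianWord (K := K) (n + 1) 0 0 h)
  have h3 : ∀ t, ¬ hermitianWord (K := K) (n + 1) 0 0 h t = 0 := fun t => by
    simp [hermitianWord, hh]
  simp only [h3] at h1
  rw [hK, mul_comm 2, pow_mul, pow_succ 3 n] at h1
  simp only [Finset.filter_false, Finset.card_empty] at h1
  nlinarith

/-- With `m = n + 1`, the nonzero weights are `6·9^n - 3^n`, `6·9^n`, `6·9^n + 2·3^n` and `9·9^n`.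
The least arises when `a ≠ 0` and the constant left after completing the square is nonzero. -/
theorem minWeight_hermitianCode {n : ℕ} (hK : Fintype.card K = 3 ^ (2 * (n + 1))) :
    minWeight (hermitianCode K (n + 1)) + 3 ^ n = 6 * (3 ^ n * 3 ^ n) := by
  have hp : 1 ≤ 3 ^ n := Nat.one_le_pow _ _ (by norm_num)
  have hw := hammingNorm_hermitianWord_of_ne_zero hK (a := 1) one_ne_zero (h := 1) one_ne_zero
  rw [← hw]
  congr 1
  refine IsLeast.csInf_eq ⟨⟨_, hermitianWord_mem _ _ _, fun h0 => ?_, rfl⟩, ?_⟩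
  · rw [h0, hammingNorm_zero] at hw
    nlinarith
  · rintro _ ⟨_, ⟨a, b, h, rfl⟩, hc, rfl⟩
    by_cases ha : a = 0
    · subst ha
      by_cases hb : b = 0
      · subst hb
        have hh : h ≠ 0 := by
          rintro rfl
          exact hc (funext fun t => by simp [hermitianWord])
        have := hammingNorm_hermitianWord_const hK hh
        nlinarith
      · have := hammingNorm_hermitianWord_linear hK hb h
        omega
    · obtain ⟨s, h', hs⟩ := exists_hermitianWord_eq_translate hK ha b h
      have h0 := hs 0
      rw [add_zero] at h0
      rw [h0, hammingNorm_translate]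
      by_cases hh : h' + 0 = 0
      · rw [hh, hammingNorm_hermitianWord_zero hK ha]; omega
      · have := hammingNorm_hermitianWord_of_ne_zero hK ha hh
        omega

end Weights

/-! ### The design code as the square of the Hermitian code -/

section SquareCode

variable {K : Type*} [Field K] [Algebra (ZMod 3) K] [Fintype K] {m : ℕ}

theorem incidenceMatrix_row {P : Type*} [Fintype P] (𝓑 : Set (Finset P)) (B : 𝓑) {c : P → ZMod 3}
    (hB : (B : Finset P) = wordSupport c) : (incidenceMatrix 𝓑).row B = c * c := by
  have key : ∀ x : ZMod 3, (if x ≠ 0 then 1 else 0) = x * x := by decide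
  funext x
  rw [Pi.mul_apply, ← key]
  simp [incidenceMatrix, hB, wordSupport]

theorem mul_self_mem_designCode {P : Type*} [Fintype P] {C : Submodule (ZMod 3) (P → ZMod 3)}
    {k : ℕ} {c : P → ZMod 3} (hc : c ∈ C) (hk : hammingNorm c = k) :
    c * c ∈ designCode (supportBlocks C k) :=
  Submodule.subset_span ⟨⟨wordSupport c, c, hc, hk, rfl⟩, incidenceMatrix_row _ _ rfl⟩

theorem designCode_le_mul {P : Type*} [Fintype P] (C : Submodule (ZMod 3) (P → ZMod 3)) (k : ℕ) :
    designCode (supportBlocks C k) ≤ C * C := by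
  refine Submodule.span_le.2 ?_
  rintro _ ⟨⟨B, c, hc, hk, hB⟩, rfl⟩
  rw [incidenceMatrix_row _ _ hB]
  exact Submodule.mul_mem_mul hc hc

theorem AffineInvariant.mul {C C' : Submodule (ZMod 3) (K → ZMod 3)} (hC : AffineInvariant C)
    (hC' : AffineInvariant C') : AffineInvariant (C * C') := by
  intro s₁ s₂ hs c hc
  induction hc using Submodule.mul_induction_on' with
  | mem_mul_mem u hu v hv => exact Submodule.mul_mem_mul (hC s₁ s₂ hs u hu) (hC' s₁ s₂ hs v hv)
  | add u _ v _ hu hv => exact Submodule.add_mem _ hu hv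

theorem hermitianWord_add (a a' : halfField K m) (b b' : K) (h h' : ZMod 3) :
    hermitianWord m a b h + hermitianWord m a' b' h' =
      hermitianWord m (a + a') (b + b') (h + h') := by
  funext t
  simp only [hermitianWord, Pi.add_apply, IntermediateField.coe_add, add_mul, map_add]
  ring

theorem hermitianWord_neg (a : halfField K m) (b : K) (h : ZMod 3) :
    -hermitianWord m a b h = hermitianWord m (-a) (-b) (-h) := by
  funext t
  simp only [hermitianWord, Pi.neg_apply, IntermediateField.coe_neg, neg_mul, map_add, map_neg]
  ring

theorem three_eq_zero {P : Type*} : (3 : P → ZMod 3) = 0 := rfl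

theorem mul_self_mem_hermitianDesignCode {n : ℕ} (hK : Fintype.card K = 3 ^ (2 * (n + 1)))
    {a : halfField K (n + 1)} (ha : a ≠ 0) (s : K) {h : ZMod 3} (hh : h ≠ 0) :
    (fun t => hermitianWord (n + 1) a 0 h (1 * t + s)) *
      (fun t => hermitianWord (n + 1) a 0 h (1 * t + s)) ∈
        designCode (hermitianBlocks K (n + 1)) := by
  refine mul_self_mem_designCode
    (affineInvariant_hermitianCode hK 1 s one_ne_zero _ (hermitianWord_mem _ _ _)) ?_
  have h1 := hammingNorm_hermitianWord_of_ne_zero hK ha hh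
  have h2 := minWeight_hermitianCode hK
  rw [hammingNorm_translate]
  omega

/-- The squares of `Tr(a t^(q+1)) + 1`, with `q = 3 ^ (n + 1)`, summed over all `a` in the subfield
cancel at each `t`, because 9 divides the order of the subfield. The term `a = 0` is the word `1`;
all others are rows of the incidence matrix. -/
theorem one_mem_hermitianDesignCode {n : ℕ} (hn : n ≠ 0)
    (hK : Fintype.card K = 3 ^ (2 * (n + 1))) :
    (1 : K → ZMod 3) ∈ designCode (hermitianBlocks K (n + 1)) := by
  classical
  have h9 : 9 ∣ Fintype.card (halfField K (n + 1)) := by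
    rw [card_halfField n.succ_ne_zero hK]
    exact pow_dvd_pow 3 (by omega : 2 ≤ n + 1)
  have hsum : ∑ a : halfField K (n + 1),
      hermitianWord (n + 1) a 0 1 * hermitianWord (n + 1) a 0 1 = 0 := by
    funext t
    have := sum_comp_eq_zero h9 (traceMul (halfNorm hK t)) fun x => (-x + 1) * (-x + 1)
    rw [Finset.sum_apply, Pi.zero_apply, ← this]
    refine Finset.sum_congr rfl fun a _ => ?_
    have e : hermitianWord (n + 1) a 0 1 t = -traceMul (halfNorm hK t) a + 1 := by
      rw [traceMul_apply, ← trace_coe_halfField n.succ_ne_zero hK, hermitianWord, zero_mul,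
        add_zero, mul_comm]
      rfl
    rw [Pi.mul_apply, e]
  rw [← Finset.add_sum_erase _ _ (Finset.mem_univ 0)] at hsum
  have h1 : hermitianWord (K := K) (n + 1) 0 0 1 = 1 := by
    funext t; simp [hermitianWord]
  rw [h1, one_mul, add_eq_zero_iff_eq_neg] at hsum
  rw [hsum]
  refine Submodule.neg_mem _ (Submodule.sum_mem _ fun a ha => ?_)
  simpa using mul_self_mem_hermitianDesignCode hK (Finset.mem_erase.1 ha).1 0 one_ne_zero

/-- With `g` the translate having zero constant, `(g + 1)²`, `(g - 1)²` and `1` lie in the design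
code. Modulo 3, `g = (g + 1)² - (g - 1)²` and `g² = -((g + 1)² + (g - 1)² + 1)`. -/
theorem hermitianWord_mem_designCode_of_ne_zero {n : ℕ} (hn : n ≠ 0)
    (hK : Fintype.card K = 3 ^ (2 * (n + 1))) {a : halfField K (n + 1)} (ha : a ≠ 0) (b : K)
    (h : ZMod 3) :
    hermitianWord (n + 1) a b h ∈ designCode (hermitianBlocks K (n + 1)) ∧
    hermitianWord (n + 1) a b h * hermitianWord (n + 1) a b h ∈
      designCode (hermitianBlocks K (n + 1)) := by
  set D := designCode (hermitianBlocks K (n + 1))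
  obtain ⟨s, h', hs⟩ := exists_hermitianWord_eq_translate hK ha b h
  set g : K → ZMod 3 := fun t => hermitianWord (n + 1) a 0 0 (1 * t + s) with hg
  have hadd : ∀ k, (fun t => hermitianWord (n + 1) a 0 k (1 * t + s)) =
      g + k • (1 : K → ZMod 3) := fun k => by
    funext t; simp [hg, hermitianWord]
  have h1 : (1 : K → ZMod 3) ∈ D := one_mem_hermitianDesignCode hn hK
  have hp := mul_self_mem_hermitianDesignCode hK ha s (h := 1) one_ne_zero
  have hm := mul_self_mem_hermitianDesignCode hK ha s (h := -1) (by decide)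
  rw [hadd] at hp hm
  have h3 := three_eq_zero (P := K)
  have hgD : g ∈ D := by
    have := Submodule.sub_mem _ hp hm
    convert this using 1
    simp only [one_smul, neg_smul]
    linear_combination (-g) * h3
  have hggD : g * g ∈ D := by
    have := Submodule.neg_mem _ (Submodule.add_mem _ (Submodule.add_mem _ hp hm) h1)
    convert this using 1
    simp only [one_smul, neg_smul]
    linear_combination (g * g + 1) * h3
  have hw := hs 0
  rw [add_zero, hadd, add_zero] at hw
  rw [hw]
  refine ⟨Submodule.add_mem _ hgD (Submodule.smul_mem _ _ h1), ?_⟩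
  have := Submodule.add_mem _ (Submodule.add_mem _ hggD (Submodule.smul_mem _ (h' + h') hgD))
    (Submodule.smul_mem _ (h' * h') h1)
  convert this using 1
  funext t
  simp
  ring

theorem mul_self_mem_hermitianDesignCode_of_mem {n : ℕ} (hn : n ≠ 0)
    (hK : Fintype.card K = 3 ^ (2 * (n + 1))) {w : K → ZMod 3}
    (hw : w ∈ hermitianCode K (n + 1)) :
    w * w ∈ designCode (hermitianBlocks K (n + 1)) := by
  obtain ⟨a, b, h, rfl⟩ := hw
  by_cases ha : a = 0
  · subst ha
    have e1 := (hermitianWord_mem_designCode_of_ne_zero hn hK one_ne_zero b h).2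
    have e2 := (hermitianWord_mem_designCode_of_ne_zero hn hK one_ne_zero (-b) (-h)).2
    have e3 := (hermitianWord_mem_designCode_of_ne_zero hn hK one_ne_zero (0 : K) 0).2
    have f1 : hermitianWord (n + 1) (1 : halfField K (n + 1)) b h =
        hermitianWord (n + 1) 1 0 0 + hermitianWord (n + 1) 0 b h := by
      rw [hermitianWord_add]; simp
    have f2 : hermitianWord (n + 1) (1 : halfField K (n + 1)) (-b) (-h) =
        hermitianWord (n + 1) 1 0 0 + -hermitianWord (n + 1) 0 b h := by
      rw [hermitianWord_neg, hermitianWord_add]; simp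
    rw [f1] at e1
    rw [f2] at e2
    generalize hermitianWord (n + 1) (1 : halfField K (n + 1)) 0 0 = A at *
    generalize hermitianWord (n + 1) (0 : halfField K (n + 1)) b h = B at *
    -- `(A + B)² + (A - B)² + A² = 3A² + 2B² = -B²`, which reaches the words `B` with `a = 0`.
    have := Submodule.neg_mem _ (Submodule.add_mem _ (Submodule.add_mem _ e1 e2) e3)
    convert this using 1
    linear_combination (A * A + B * B) * three_eq_zero (P := K)
  · exact (hermitianWord_mem_designCode_of_ne_zero hn hK ha b h).2

/-- The code of the minimum-weight design is the componentwise square of the Hermitian code. -/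
theorem designCode_hermitianBlocks {n : ℕ} (hn : n ≠ 0)
    (hK : Fintype.card K = 3 ^ (2 * (n + 1))) :
    designCode (hermitianBlocks K (n + 1)) = hermitianCode K (n + 1) * hermitianCode K (n + 1) := by
  refine le_antisymm (designCode_le_mul _ _) (Submodule.mul_le.2 fun u hu v hv => ?_)
  -- Polarization: `u² + v² - (u + v)² = -2uv = uv`.
  have := Submodule.sub_mem _ (Submodule.add_mem _
    (mul_self_mem_hermitianDesignCode_of_mem hn hK hu)
    (mul_self_mem_hermitianDesignCode_of_mem hn hK hv))
    (mul_self_mem_hermitianDesignCode_of_mem hn hK (Submodule.add_mem _ hu hv))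
  convert this using 1
  linear_combination (u * v) * three_eq_zero (P := K)

theorem sum_eq_zero_of_mem_designCode {P : Type*} [Fintype P]
    {C : Submodule (ZMod 3) (P → ZMod 3)} {k : ℕ} (hk : 3 ∣ k) {c : P → ZMod 3}
    (hc : c ∈ designCode (supportBlocks C k)) : ∑ x, c x = 0 := by
  induction hc using Submodule.span_induction with
  | mem c hc =>
    obtain ⟨⟨B, c, -, hck, rfl⟩, rfl⟩ := hc
    rw [hammingNorm_eq_card_wordSupport] at hck
    simp only [incidenceMatrix, Matrix.row, Matrix.of_apply, Finset.sum_boole]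
    simpa [hck] using (ZMod.natCast_eq_zero_iff k 3).2 hk
  | zero => simp
  | add u v _ _ hu hv => simp [Finset.sum_add_distrib, hu, hv]
  | smul r u _ hu => simp [← Finset.mul_sum, hu]

theorem hammingNorm_ne_one_of_sum_eq_zero {P : Type*} [Fintype P] {c : P → ZMod 3}
    (hc : ∑ x, c x = 0) : hammingNorm c ≠ 1 := by
  intro h
  rw [hammingNorm_eq_card_wordSupport, Finset.card_eq_one] at h
  obtain ⟨x, hx⟩ := h
  have hmem : ∀ y, c y ≠ 0 ↔ y = x := fun y => by
    simpa [wordSupport] using Finset.ext_iff.1 hx y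
  rw [Finset.sum_eq_single x (fun y _ hy => by_contra fun h => hy ((hmem y).1 h)) (by simp)] at hc
  exact (hmem x).2 rfl hc

end SquareCode

/-! ### The square of the Hermitian code as a span of trace words -/

section Spanning

variable {K : Type*} [Field K] [Algebra (ZMod 3) K] [Fintype K] {m : ℕ}

/-- The code spanned by the evaluation words `spanningWord`. -/
def spanningCode (hK : Fintype.card K = 3 ^ (2 * m)) : Submodule (ZMod 3) (K → ZMod 3) :=
  Submodule.span (ZMod 3)
    {f | ∃ (b₁ : Fin m → K) (b₂ : Fin (2 * m) → K) (c : Fin m → halfField K m) (b : K)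
      (h : ZMod 3), f = spanningWord hK b₁ b₂ c b h}

/-- The word `t ↦ Tr_{2m}(β t^e)`. -/
def traceMonomial (β : K) (e : ℕ) : K → ZMod 3 :=
  fun t => Algebra.trace (ZMod 3) K (β * t ^ e)

/-- The word `t ↦ Tr_m(γ N(t)^e)`. -/
def traceNormMonomial (hK : Fintype.card K = 3 ^ (2 * m)) (γ : halfField K m) (e : ℕ) :
    K → ZMod 3 :=
  fun t => Algebra.trace (ZMod 3) (halfField K m) (γ * halfNorm hK t ^ e)

theorem spanningWord_eq (hK : Fintype.card K = 3 ^ (2 * m)) (b₁ : Fin m → K)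
    (b₂ : Fin (2 * m) → K) (c : Fin m → halfField K m) (b : K) (h : ZMod 3) :
    spanningWord hK b₁ b₂ c b h =
      ∑ i : Fin m, traceMonomial (b₁ i) ((3 ^ m + 1) * 3 ^ (i : ℕ) + 1) +
      ∑ i : Fin (2 * m), traceMonomial (b₂ i) (3 ^ (i : ℕ) + 1) +
      ∑ i : Fin m, traceNormMonomial hK (c i) (3 ^ (i : ℕ) + 1) +
      traceMonomial b 1 + h • (1 : K → ZMod 3) := by
  have hN : ∀ (t : K) (i : Fin m),
      (⟨t ^ ((3 ^ m + 1) * (3 ^ (i : ℕ) + 1)), pow_mem_halfField hK t _⟩ : halfField K m) =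
        halfNorm hK t ^ (3 ^ (i : ℕ) + 1) := fun t i =>
    Subtype.ext (by rw [SubmonoidClass.coe_pow]; exact pow_mul _ _ _)
  funext t
  simp only [spanningWord, traceMonomial, traceNormMonomial, Pi.add_apply, Finset.sum_apply, hN,
    Pi.smul_apply, Pi.one_apply, smul_eq_mul, mul_one, pow_one]

theorem spanningWord_mem (hK : Fintype.card K = 3 ^ (2 * m)) (b₁ : Fin m → K)
    (b₂ : Fin (2 * m) → K) (c : Fin m → halfField K m) (b : K) (h : ZMod 3) :
    spanningWord hK b₁ b₂ c b h ∈ spanningCode hK :=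
  Submodule.subset_span ⟨b₁, b₂, c, b, h, rfl⟩

@[simp] theorem traceMonomial_zero (e : ℕ) : traceMonomial (0 : K) e = 0 := by
  funext t; simp [traceMonomial]

@[simp] theorem traceNormMonomial_zero (hK : Fintype.card K = 3 ^ (2 * m)) (e : ℕ) :
    traceNormMonomial hK 0 e = 0 := by
  funext t; simp [traceNormMonomial]

theorem traceMonomial_mul_norm_sum_mem (hK : Fintype.card K = 3 ^ (2 * m)) (b₁ : Fin m → K) :
    ∑ i : Fin m, traceMonomial (b₁ i) ((3 ^ m + 1) * 3 ^ (i : ℕ) + 1) ∈ spanningCode hK := by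
  simpa [spanningWord_eq] using spanningWord_mem hK b₁ 0 0 0 0

theorem traceMonomial_sum_mem (hK : Fintype.card K = 3 ^ (2 * m)) (b₂ : Fin (2 * m) → K) :
    ∑ i : Fin (2 * m), traceMonomial (b₂ i) (3 ^ (i : ℕ) + 1) ∈ spanningCode hK := by
  simpa [spanningWord_eq] using spanningWord_mem hK 0 b₂ 0 0 0

theorem traceNormMonomial_sum_mem (hK : Fintype.card K = 3 ^ (2 * m))
    (c : Fin m → halfField K m) :
    ∑ i : Fin m, traceNormMonomial hK (c i) (3 ^ (i : ℕ) + 1) ∈ spanningCode hK := by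
  simpa [spanningWord_eq] using spanningWord_mem hK 0 0 c 0 0

theorem traceMonomial_one_mem (hK : Fintype.card K = 3 ^ (2 * m)) (b : K) :
    traceMonomial b 1 ∈ spanningCode hK := by
  simpa [spanningWord_eq] using spanningWord_mem hK 0 0 0 b 0

theorem one_mem_spanningCode (hK : Fintype.card K = 3 ^ (2 * m)) :
    (1 : K → ZMod 3) ∈ spanningCode hK := by
  simpa [spanningWord_eq] using spanningWord_mem hK 0 0 0 0 1

theorem traceMonomial_norm_mem (hm : m ≠ 0) (hK : Fintype.card K = 3 ^ (2 * m)) (a : K) :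
    traceMonomial a (3 ^ m + 1) ∈ spanningCode hK := by
  classical
  -- The exponent `3 ^ m + 1` is the term `i = m` of the second sum, which runs up to `2 * m - 1`.
  have h := traceMonomial_sum_mem hK (Pi.single ⟨m, by omega⟩ a)
  rwa [Finset.sum_eq_single ⟨m, by omega⟩ (fun j _ hj => by simp [hj]) (by simp),
    Pi.single_eq_same] at h

theorem hermitianWord_eq (a : halfField K m) (b : K) (h : ZMod 3) :
    hermitianWord m a b h =
      traceMonomial (a : K) (3 ^ m + 1) + traceMonomial b 1 + h • (1 : K → ZMod 3) := by
  funext t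
  simp [hermitianWord, traceMonomial]

theorem traceMonomial_norm (hm : m ≠ 0) (hK : Fintype.card K = 3 ^ (2 * m)) (a : halfField K m) :
    traceMonomial (a : K) (3 ^ m + 1) = -traceNormMonomial hK a 1 := by
  funext t
  rw [Pi.neg_apply, traceNormMonomial, ← trace_coe_halfField hm hK, pow_one]
  rfl

theorem traceMonomial_mul_traceMonomial (hK : Fintype.card K = 3 ^ (2 * m)) (b b' : K) :
    traceMonomial b 1 * traceMonomial b' 1 =
      ∑ i : Fin (2 * m), traceMonomial (b ^ 3 ^ (i : ℕ) * b') (3 ^ (i : ℕ) + 1) := by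
  funext t
  simp only [Pi.mul_apply, Finset.sum_apply, traceMonomial, pow_one]
  rw [trace_mul_trace (E := K) hK]
  refine Finset.sum_congr rfl fun i _ => congrArg _ ?_
  simp only [Algebra.algebraMap_self, RingHom.id_apply]
  ring

theorem traceNormMonomial_mul_traceMonomial (hm : m ≠ 0) (hK : Fintype.card K = 3 ^ (2 * m))
    (a : halfField K m) (b : K) :
    traceNormMonomial hK a 1 * traceMonomial b 1 =
      ∑ i : Fin m, traceMonomial ((a : K) ^ 3 ^ (i : ℕ) * b) ((3 ^ m + 1) * 3 ^ (i : ℕ) + 1) := by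
  funext t
  simp only [Pi.mul_apply, Finset.sum_apply, traceMonomial, traceNormMonomial, pow_one]
  rw [trace_mul_trace (E := K) (card_halfField hm hK)]
  refine Finset.sum_congr rfl fun i _ => congrArg _ ?_
  change ((a : K) * t ^ (3 ^ m + 1)) ^ 3 ^ (i : ℕ) * (b * t) = _
  rw [mul_pow, pow_succ t (_ * _), pow_mul]
  ring

theorem traceNormMonomial_mul_traceNormMonomial (hm : m ≠ 0)
    (hK : Fintype.card K = 3 ^ (2 * m)) (a a' : halfField K m) :
    traceNormMonomial hK a 1 * traceNormMonomial hK a' 1 =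
      ∑ i : Fin m, traceNormMonomial hK (a ^ 3 ^ (i : ℕ) * a') (3 ^ (i : ℕ) + 1) := by
  funext t
  simp only [Pi.mul_apply, Finset.sum_apply, traceNormMonomial, pow_one]
  rw [trace_mul_trace (E := halfField K m) (card_halfField hm hK)]
  refine Finset.sum_congr rfl fun i _ => congrArg _ ?_
  simp only [Algebra.algebraMap_self, RingHom.id_apply]
  ring

theorem mul_le_spanningCode (hm : m ≠ 0) (hK : Fintype.card K = 3 ^ (2 * m)) :
    hermitianCode K m * hermitianCode K m ≤ spanningCode hK := by
  refine Submodule.mul_le.2 ?_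
  rintro _ ⟨a, b, h, rfl⟩ _ ⟨a', b', h', rfl⟩
  rw [hermitianWord_eq, hermitianWord_eq]
  have hA : ∀ a : halfField K m, traceMonomial (a : K) (3 ^ m + 1) ∈ spanningCode hK :=
    fun a => traceMonomial_norm_mem hm hK a
  have hB := traceMonomial_one_mem hK
  have hAA : traceMonomial (a : K) (3 ^ m + 1) * traceMonomial (a' : K) (3 ^ m + 1) ∈
      spanningCode hK := by
    rw [traceMonomial_norm hm hK, traceMonomial_norm hm hK, neg_mul_neg,
      traceNormMonomial_mul_traceNormMonomial hm]
    exact traceNormMonomial_sum_mem hK _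
  have hAB : ∀ (a : halfField K m) (b : K),
      traceMonomial (a : K) (3 ^ m + 1) * traceMonomial b 1 ∈ spanningCode hK := fun a b => by
    rw [traceMonomial_norm hm hK, neg_mul, traceNormMonomial_mul_traceMonomial hm]
    exact Submodule.neg_mem _ (traceMonomial_mul_norm_sum_mem hK _)
  have hBB : traceMonomial b 1 * traceMonomial b' 1 ∈ spanningCode hK := by
    rw [traceMonomial_mul_traceMonomial hK]
    exact traceMonomial_sum_mem hK _
  have hBA : traceMonomial b 1 * traceMonomial (a' : K) (3 ^ m + 1) ∈ spanningCode hK :=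
    mul_comm (traceMonomial b 1) _ ▸ hAB a' b
  have h1 := one_mem_spanningCode hK
  simp only [add_mul, mul_add, smul_mul_assoc, mul_smul_comm, mul_one, one_mul]
  refine add_mem (add_mem (add_mem (add_mem hAA hBA) ?_) (add_mem (add_mem (hAB _ _) hBB) ?_))
    (Submodule.smul_mem _ _ (add_mem (add_mem ?_ ?_) ?_))
  all_goals
    repeat refine Submodule.smul_mem _ _ ?_
    first | exact hA _ | exact hB _ | exact h1

theorem traceMonomial_one_mem_hermitianCode (b : K) : traceMonomial b 1 ∈ hermitianCode K m :=
  ⟨0, b, 0, by simp [hermitianWord_eq]⟩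

theorem one_mem_hermitianCode : (1 : K → ZMod 3) ∈ hermitianCode K m :=
  ⟨0, 0, 1, by simp [hermitianWord_eq]⟩

theorem traceNormMonomial_one_mem_hermitianCode (hm : m ≠ 0)
    (hK : Fintype.card K = 3 ^ (2 * m)) (a : halfField K m) :
    traceNormMonomial hK a 1 ∈ hermitianCode K m := by
  rw [← neg_neg (traceNormMonomial hK a 1), ← traceMonomial_norm hm]
  exact neg_mem ⟨a, 0, 0, by simp [hermitianWord_eq]⟩

/-- Twisting the two factors by `a` and `(a ^ 3 ^ i)⁻¹` and summing over units kills every term of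
the product expansion except the `i`-th, which survives with factor `-1`. -/
theorem traceMonomial_mem_mul (hK : Fintype.card K = 3 ^ (2 * m)) (β : K) (i : Fin (2 * m)) :
    traceMonomial β (3 ^ (i : ℕ) + 1) ∈ hermitianCode K m * hermitianCode K m := by
  classical
  have h : traceMonomial β (3 ^ (i : ℕ) + 1) = -∑ a : Kˣ, traceMonomial (a : K) 1 *
      traceMonomial (β * ((a : K) ^ 3 ^ (i : ℕ))⁻¹) 1 := by
    funext t
    have := sum_units_trace_mul_trace (E := K) hK i t β t
    simp only [Algebra.algebraMap_self, RingHom.id_apply] at this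
    simp only [Pi.neg_apply, Finset.sum_apply, Pi.mul_apply, traceMonomial, pow_one]
    rw [this, neg_neg, pow_succ]
  rw [h]
  exact neg_mem (sum_mem fun a _ => Submodule.mul_mem_mul
    (traceMonomial_one_mem_hermitianCode _) (traceMonomial_one_mem_hermitianCode _))

theorem traceMonomial_mul_norm_mem_mul (hm : m ≠ 0) (hK : Fintype.card K = 3 ^ (2 * m)) (β : K)
    (i : Fin m) :
    traceMonomial β ((3 ^ m + 1) * 3 ^ (i : ℕ) + 1) ∈
      hermitianCode K m * hermitianCode K m := by
  classical
  have h : traceMonomial β ((3 ^ m + 1) * 3 ^ (i : ℕ) + 1) =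
      -∑ a : (halfField K m)ˣ, traceNormMonomial hK (a : halfField K m) 1 *
        traceMonomial (β * (((a : halfField K m) ^ 3 ^ (i : ℕ))⁻¹ : halfField K m)) 1 := by
    funext t
    have := sum_units_trace_mul_trace (E := K) (card_halfField hm hK) i (halfNorm hK t) β t
    simp only [Pi.neg_apply, Finset.sum_apply, Pi.mul_apply, traceMonomial, traceNormMonomial,
      pow_one]
    rw [← neg_eq_iff_eq_neg, pow_succ, pow_mul]
    exact this.symm
  rw [h]
  exact neg_mem (sum_mem fun a _ => Submodule.mul_mem_mul
    (traceNormMonomial_one_mem_hermitianCode hm hK _) (traceMonomial_one_mem_hermitianCode _))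

theorem traceNormMonomial_mem_mul (hm : m ≠ 0) (hK : Fintype.card K = 3 ^ (2 * m))
    (γ : halfField K m) (i : Fin m) :
    traceNormMonomial hK γ (3 ^ (i : ℕ) + 1) ∈ hermitianCode K m * hermitianCode K m := by
  classical
  have h : traceNormMonomial hK γ (3 ^ (i : ℕ) + 1) =
      -∑ a : (halfField K m)ˣ, traceNormMonomial hK (a : halfField K m) 1 *
        traceNormMonomial hK (γ * ((a : halfField K m) ^ 3 ^ (i : ℕ))⁻¹) 1 := by
    funext t
    have := sum_units_trace_mul_trace (E := halfField K m) (card_halfField hm hK) i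
      (halfNorm hK t) γ (halfNorm hK t)
    simp only [Algebra.algebraMap_self, RingHom.id_apply] at this
    simp only [Pi.neg_apply, Finset.sum_apply, Pi.mul_apply, traceNormMonomial, pow_one]
    rw [this, neg_neg, pow_succ]
  rw [h]
  exact neg_mem (sum_mem fun a _ => Submodule.mul_mem_mul
    (traceNormMonomial_one_mem_hermitianCode hm hK _)
    (traceNormMonomial_one_mem_hermitianCode hm hK _))

/-- The componentwise square of the Hermitian code is the span of the evaluation words. -/
theorem hermitianCode_mul_self (hm : m ≠ 0) (hK : Fintype.card K = 3 ^ (2 * m)) :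
    hermitianCode K m * hermitianCode K m = spanningCode hK := by
  refine le_antisymm (mul_le_spanningCode hm hK) (Submodule.span_le.2 ?_)
  rintro _ ⟨b₁, b₂, c, b, h, rfl⟩
  rw [spanningWord_eq]
  have hle : ∀ {w}, w ∈ hermitianCode K m → w ∈ hermitianCode K m * hermitianCode K m :=
    fun {w} hw => mul_one w ▸ Submodule.mul_mem_mul hw one_mem_hermitianCode
  exact add_mem (add_mem (add_mem (add_mem
    (sum_mem fun i _ => traceMonomial_mul_norm_mem_mul hm hK _ i)
    (sum_mem fun i _ => traceMonomial_mem_mul hK _ i))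
    (sum_mem fun i _ => traceNormMonomial_mem_mul hm hK _ i))
    (hle (traceMonomial_one_mem_hermitianCode b)))
    (Submodule.smul_mem _ h (hle one_mem_hermitianCode))

end Spanning

end HermitianDesign

end

/-! ### Assembly of the main theorem -/

theorem theorem3p15 (m : ℕ) (hm : 2 ≤ m) (K : Type*) [Field K] [Fintype K]
    [Algebra (ZMod 3) K] (hK : Fintype.card K = 3 ^ (2 * m)) :
    -- the code `𝒞(2m,3)` is affine-invariant and its minimum-weight supports form a 2-design
    HermitianDesign.AffineInvariant (HermitianDesign.hermitianCode K m) ∧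
    (∃ l, HermitianDesign.IsDesign 2
      (HermitianDesign.minWeight (HermitianDesign.hermitianCode K m)) l
      (HermitianDesign.hermitianBlocks K m)) ∧
    -- the ternary code of this design
    HermitianDesign.designCode (HermitianDesign.hermitianBlocks K m) =
      Submodule.span (ZMod 3)
        {f | ∃ (b₁ : Fin m → K) (b₂ : Fin (2 * m) → K)
          (c : Fin m → HermitianDesign.halfField K m) (b : K) (h : ZMod 3),
          f = HermitianDesign.spanningWord hK b₁ b₂ c b h} ∧
    HermitianDesign.AffineInvariant
      (HermitianDesign.designCode (HermitianDesign.hermitianBlocks K m)) ∧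
    HermitianDesign.HoldsDesigns 2
      (HermitianDesign.designCode (HermitianDesign.hermitianBlocks K m)) := by
  open HermitianDesign in
  obtain ⟨n, rfl⟩ := Nat.exists_eq_add_of_le' (show 1 ≤ m by omega)
  have hn : n ≠ 0 := by omega
  have hV := affineInvariant_hermitianCode hK
  have hd := minWeight_hermitianCode hK
  have h3 : 3 ∣ 3 ^ n := dvd_pow_self 3 hn
  -- The minimum weight `6·9^n - 3^n` is divisible by 3 because `n ≥ 1`; this later excludes words
  -- of weight 1.
  have hd3 : 3 ∣ minWeight (hermitianCode K (n + 1)) := by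
    rw [← Nat.dvd_add_left h3, hd]
    exact Dvd.dvd.mul_left (Dvd.dvd.mul_left h3 _) _
  have hpos : 2 ≤ minWeight (hermitianCode K (n + 1)) := by
    have : 1 ≤ 3 ^ n := Nat.one_le_pow _ _ (by norm_num)
    nlinarith
  have hD := designCode_hermitianBlocks hn hK
  have hDinv : AffineInvariant (designCode (hermitianBlocks K (n + 1))) := hD ▸ hV.mul hV
  refine ⟨hV, ?_, hD.trans (hermitianCode_mul_self n.succ_ne_zero hK), hDinv, ?_⟩
  · refine hV.exists_isDesign hpos
      ⟨_, hermitianWord_mem 1 0 1, Nat.add_right_cancel (Eq.trans ?_ hd.symm)⟩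
    exact hammingNorm_hermitianWord_of_ne_zero hK one_ne_zero one_ne_zero
  · rintro k hk ⟨c, hc, rfl⟩
    have := hammingNorm_ne_one_of_sum_eq_zero (sum_eq_zero_of_mem_designCode hd3 hc)
    exact hDinv.exists_isDesign (by omega) ⟨c, hc, rfl⟩
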